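/- Digraphs have no loops and no multiple edges, but may contain both $u\to v$ and $v\to u$; labeled objects with $n$ vertices have a fixed vertex set of $n$ labels. A digraph is strongly connected if it has at least one vertex and every vertex can be reached from every vertex by a (possibly empty) directed path. Let $s_n(w)=\sum_m s_{n,m}w^m$ and $g_n(w)=\sum_m g_{n,m}w^m$, where $s_{n,m}$ is the number of strongly connected labeled digraphs and $g_{n,m}$ the number of labeled simple graphs with $n$ vertices and $m$ edges, and let $$\mathrm{SCC}(z,w)=\sum_{n\ge 0}s_n(w)\frac{z^n}{n!},\qquad G(z,w)=\sum_{n\ge 0}g_n(w)\frac{z^n}{n!}\qquad\text{in }\mathbb{Q}[w][[z]]$$ be their exponential generating functions. The exponential Hadamard product is defined by $\bigl(\sum_n a_n\frac{z^n}{n!}\bigr)\odot\bigl(\sum_n b_n\frac{z^n}{n!}\bigr)=\sum_n a_nb_n\frac{z^n}{n!}$, and $\log$ of a formal power series in $z$ with constant term $1$ is given by $\log(1+F)=\sum_{k\ge1}\frac{(-1)^{k+1}}{k}F^k$. **Corollary.** We have $G(z,w)=\sum_{n\ge 0}(1+w)^{\binom n2}\frac{z^n}{n!}$; the series $G(z,w)$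 is invertible in $\mathbb{Q}[w][[z]]$, the series $G(z,w)\odot\frac{1}{G(z,w)}$ has constant term $1$, and $$\mathrm{SCC}(z,w)=-\log\left(G(z,w)\odot\frac{1}{G(z,w)}\right).$$ -/

import Mathlib

namespace DigraphEGF

open Polynomial

/-- The exponential generating function `∑ aₙ(w) zⁿ / n!` of a sequence of polynomials in `w`:
a formal power series in `z` with coefficients in `ℚ[w]`. -/
noncomputable def egf (a : ℕ → ℚ[X]) : PowerSeries ℚ[X] :=
  PowerSeries.mk fun n => C ((n.factorial : ℚ)⁻¹) * a n

/-- The exponential Hadamard product with respect to `z`: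
`(∑ aₙ zⁿ / n!) ⊙ (∑ bₙ zⁿ / n!) = ∑ aₙ bₙ zⁿ / n!`, where `aₙ = n! [zⁿ] A`. -/
noncomputable def hadamard (A B : PowerSeries ℚ[X]) : PowerSeries ℚ[X] :=
  egf fun n => ((n.factorial : ℚ[X]) * PowerSeries.coeff n A) *
    ((n.factorial : ℚ[X]) * PowerSeries.coeff n B)

/-- Number of directed edges of a digraph; `u → v` and `v → u` are different edges. -/
noncomputable def numArcs {n : ℕ} (D : Digraph (Fin n)) : ℕ :=
  {p : Fin n × Fin n | D.Adj p.1 p.2}.ncard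

/-- A digraph in the sense used here: no loops (multiple edges are impossible in `Digraph`). -/
def Loopless {n : ℕ} (D : Digraph (Fin n)) : Prop :=
  ∀ v, ¬ D.Adj v v

/-- Strongly connected: nonempty, and every vertex is reachable from every vertex by a
(possibly empty) directed path. The empty digraph is not strongly connected by convention. -/
def StronglyConnected {n : ℕ} (D : Digraph (Fin n)) : Prop :=
  0 < n ∧ ∀ u v, Relation.ReflTransGen D.Adj u v

open Classical in
/-- The polynomial in `w` whose coefficient of `wᵐ` is the number of strongly connected loopless
digraphs with labelled vertex set `Fin n` and exactly `m` edges. -/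
noncomputable def sccPoly (n : ℕ) : ℚ[X] :=
  ∑ D : Digraph (Fin n) with Loopless D ∧ StronglyConnected D, X ^ numArcs D

open Classical in
/-- The polynomial in `w` whose coefficient of `wᵐ` is the number of simple graphs with labelled
vertex set `Fin n` and exactly `m` edges. -/
noncomputable def graphPoly (n : ℕ) : ℚ[X] :=
  ∑ H : SimpleGraph (Fin n), X ^ H.edgeSet.ncard

/-- The EGF of strongly connected digraphs. -/
noncomputable def SCC : PowerSeries ℚ[X] := egf sccPoly

/-- The EGF of simple graphs. -/
noncomputable def G : PowerSeries ℚ[X] := egf graphPoly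

/-- The series `1 / A` for a series `A` with constant coefficient `1`. -/
noncomputable def recip (A : PowerSeries ℚ[X]) : PowerSeries ℚ[X] :=
  PowerSeries.invOfUnit A 1

theorem mul_recip (A : PowerSeries ℚ[X]) (hA : PowerSeries.constantCoeff A = 1) :
    A * recip A = 1 :=
  PowerSeries.mul_invOfUnit A 1 (by simpa using hA)

theorem coeff_sccPoly (n m : ℕ) :
    (sccPoly n).coeff m =
      {D : Digraph (Fin n) | Loopless D ∧ StronglyConnected D ∧ numArcs D = m}.ncard := by
  classical
  simp only [sccPoly, finsetSum_coeff, coeff_X_pow]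
  rw [Finset.sum_boole, Finset.filter_filter, ← Set.ncard_coe_finset]
  congr 2
  ext D
  simp [and_assoc, eq_comm]

theorem coeff_graphPoly (n m : ℕ) :
    (graphPoly n).coeff m = {H : SimpleGraph (Fin n) | H.edgeSet.ncard = m}.ncard := by
  classical
  simp only [graphPoly, finsetSum_coeff, coeff_X_pow]
  rw [Finset.sum_boole, ← Set.ncard_coe_finset]
  congr 2
  ext H
  simp [eq_comm]

end DigraphEGF

/-! Let `d_S` be the sum, over disjoint unions of strongly connected digraphs on `S`, of `(-1)` to
the number of components times `w` to the number of arcs (`signedWeight`).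

In a digraph on nonempty `W`, the signed sum over unions `S` of source components vanishes: toggling
one source component reverses the sign (`sum_componentSign_eq_zero`). Counting the pairs (digraph,
`S`) by `S` first, the arcs with head outside `S` are free, so `∑_S d_S (1+w)^((|W|-|S|)(|W|-1))` is
`1` for empty `W` and `0` otherwise. By `choose_two_add`, multiplying the `n`th coefficient of
`(1/G)·G = 1` by `(1+w)^(n choose 2)` gives the same recursion for the coefficients of `G ⊙ (1/G)`.
Hence these coefficients are the `d_S` (`signedWeight_eq_hadamardCoeff`).

Splitting off the component of a marked vertex (`signedWeight_insert`) gives `D' = -D · SCC'` for `D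
= G ⊙ (1/G)`. Comparing derivatives and constant terms yields `SCC = -log D`. -/

namespace DigraphEGF

open Polynomial Finset

/-! ### Reachability, source components and the sign-reversing involution -/

section Reachability

variable {α : Type*}

/-- Reachability by a directed path whose arcs lie in the finite set `A`. -/
def Reach (A : Finset (α × α)) : α → α → Prop :=
  Relation.ReflTransGen fun u v => (u, v) ∈ A

theorem Reach.refl (A : Finset (α × α)) (u : α) : Reach A u u :=
  Relation.ReflTransGen.refl

theorem Reach.trans {A : Finset (α × α)} {u v w : α} (h : Reach A u v) (h' : Reach A v w) :
    Reach A u w :=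
  Relation.ReflTransGen.trans h h'

theorem Reach.mono {A B : Finset (α × α)} (hAB : A ⊆ B) {u v : α} (h : Reach A u v) :
    Reach B u v :=
  Relation.ReflTransGen.mono (fun _ _ hab => hAB hab) _ _ h

/-- If every arc of `A` that ends in `S` starts in `S`, then `S` is closed under predecessors. -/
theorem Reach.mem_of_mem {A : Finset (α × α)} {S : Finset α}
    (hA : ∀ p ∈ A, p.2 ∈ S → p.1 ∈ S) {u v : α} (h : Reach A u v) (hv : v ∈ S) : u ∈ S := by
  induction h using Relation.ReflTransGen.head_induction_on with
  | refl => exact hv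
  | head hab _ ih => exact hA _ hab ih

/-- Arcs ending outside `S` do not affect reachability of vertices of `S` if all other arcs stay
inside `S`. -/
theorem reach_union_iff [DecidableEq α] {A B : Finset (α × α)} {S : Finset α}
    (hA : A ⊆ S.offDiag) (hB : ∀ p ∈ B, p.2 ∉ S) {u v : α} (hv : v ∈ S) :
    Reach (A ∪ B) u v ↔ Reach A u v := by
  refine ⟨fun h => ?_, fun h => h.mono subset_union_left⟩
  suffices u ∈ S ∧ Reach A u v from this.2
  induction h using Relation.ReflTransGen.head_induction_on with
  | refl => exact ⟨hv, Reach.refl A v⟩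
  | @head a c hac _ ih =>
    have hac' : (a, c) ∈ A := by
      rcases mem_union.1 hac with h | h
      · exact h
      · exact absurd ih.1 (hB _ h)
    exact ⟨(mem_offDiag.1 (hA hac')).1, Relation.ReflTransGen.head hac' ih.2⟩

theorem Reach.mem_of_subset_offDiag [DecidableEq α] {A : Finset (α × α)} {S : Finset α}
    (hA : A ⊆ S.offDiag) {u v : α} (h : Reach A u v) (hv : v ∈ S) : u ∈ S :=
  h.mem_of_mem (fun _ hp _ => (mem_offDiag.1 (hA hp)).1) hv

/-- `S` is a union of source strong components of the digraph `A`. -/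
def IsSourceUnion (A : Finset (α × α)) (S : Finset α) : Prop :=
  ∀ v ∈ S, ∀ u, Reach A u v → u ∈ S ∧ Reach A v u

/-- All vertices of `K` are mutually reachable by arcs of `A`. -/
def IsStrongOn (A : Finset (α × α)) (K : Finset α) : Prop :=
  ∀ u ∈ K, ∀ v ∈ K, Reach A u v

theorem isSourceUnion_union_iff [DecidableEq α] {A B : Finset (α × α)} {S : Finset α}
    (hA : A ⊆ S.offDiag) (hB : ∀ p ∈ B, p.2 ∉ S) :
    IsSourceUnion (A ∪ B) S ↔ IsSourceUnion A S := by
  refine forall₂_congr fun v hv => forall_congr' fun u => ?_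
  rw [reach_union_iff hA hB hv]
  refine imp_congr_right fun _ => and_congr_right fun hu => ?_
  rw [reach_union_iff hA hB hu]

variable [Fintype α]

open Classical in
/-- The strong component of `v`. -/
noncomputable def component (A : Finset (α × α)) (v : α) : Finset α :=
  {u | Reach A u v ∧ Reach A v u}

theorem mem_component {A : Finset (α × α)} {u v : α} :
    u ∈ component A v ↔ Reach A u v ∧ Reach A v u := by
  simp [component]

theorem self_mem_component (A : Finset (α × α)) (v : α) : v ∈ component A v :=
  mem_component.2 ⟨Reach.refl A v, Reach.refl A v⟩

theorem component_eq_of_mem {A : Finset (α × α)} {u v : α} (h : u ∈ component A v) :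
    component A u = component A v := by
  rw [mem_component] at h
  ext x
  simp only [mem_component]
  exact ⟨fun hx => ⟨hx.1.trans h.1, h.2.trans hx.2⟩, fun hx => ⟨hx.1.trans h.2, h.1.trans hx.2⟩⟩

theorem IsSourceUnion.component_subset {A : Finset (α × α)} {S : Finset α}
    (h : IsSourceUnion A S) {v : α} (hv : v ∈ S) : component A v ⊆ S :=
  fun _ hu => (h v hv _ (mem_component.1 hu).1).1

theorem IsSourceUnion.disjoint_component {A : Finset (α × α)} {S : Finset α} {v : α}
    (hS : IsSourceUnion A S) (hv : v ∉ S) : Disjoint S (component A v) :=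
  disjoint_left.2 fun x hx hxv => hv (hS x hx v (mem_component.1 hxv).2).1

variable [DecidableEq α]

/-- `(-1)` to the number of strong components meeting `S`. -/
noncomputable def componentSign (A : Finset (α × α)) (S : Finset α) : ℚ[X] :=
  (-1) ^ #(S.image (component A))

theorem component_union_eq {A B : Finset (α × α)} {S : Finset α}
    (hA : A ⊆ S.offDiag) (hB : ∀ p ∈ B, p.2 ∉ S) {v : α} (hv : v ∈ S) :
    component (A ∪ B) v = component A v := by
  ext u
  simp only [mem_component, reach_union_iff hA hB hv]
  refine and_congr_right fun h => ?_
  rw [reach_union_iff hA hB (h.mem_of_subset_offDiag hA hv)]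

theorem componentSign_union_eq {A B : Finset (α × α)} {S : Finset α}
    (hA : A ⊆ S.offDiag) (hB : ∀ p ∈ B, p.2 ∉ S) :
    componentSign (A ∪ B) S = componentSign A S := by
  unfold componentSign
  rw [image_congr (g := component A) fun v hv => component_union_eq hA hB hv]

/-- A nonempty finite digraph has a source component. -/
theorem exists_source (A : Finset (α × α)) {W : Finset α} (hA : A ⊆ W.offDiag)
    (hW : W.Nonempty) : ∃ v ∈ W, ∀ u, Reach A u v → Reach A v u := by
  classical
  -- Take `v` with fewest predecessors: a predecessor `u` not reachable from `v` would have strictly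
  -- fewer, as it loses `v` itself.
  obtain ⟨v, hv, hmin⟩ := W.exists_min_image (fun v => #{u | Reach A u v}) hW
  refine ⟨v, hv, fun u huv => ?_⟩
  by_contra hvu
  refine (hmin u (huv.mem_of_subset_offDiag hA hv)).not_gt (card_lt_card ?_)
  rw [ssubset_iff_of_subset fun x hx => by
    simp only [mem_filter, mem_univ, true_and] at hx ⊢
    exact hx.trans huv]
  exact ⟨v, by simpa using Reach.refl A v, by simpa using hvu⟩

theorem isSourceUnion_union_component {A : Finset (α × α)} {S : Finset α} {v : α}
    (hv : ∀ u, Reach A u v → Reach A v u) (hS : IsSourceUnion A S) :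
    IsSourceUnion A (S ∪ component A v) := by
  intro x hx u hu
  rcases mem_union.1 hx with hx | hx
  · exact ⟨mem_union_left _ (hS x hx u hu).1, (hS x hx u hu).2⟩
  · rw [mem_component] at hx
    have huv := hu.trans hx.1
    exact ⟨mem_union_right _ (mem_component.2 ⟨huv, hv u huv⟩), hx.1.trans (hv u huv)⟩

/-- Inside a source union reachability is symmetric, so a predecessor of a vertex outside the
component of `v` is outside it too. -/
theorem isSourceUnion_sdiff_component {A : Finset (α × α)} {S : Finset α} {v : α}
    (hS : IsSourceUnion A S) : IsSourceUnion A (S \ component A v) := by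
  intro x hx u hu
  rw [mem_sdiff] at hx
  obtain ⟨huS, hxu⟩ := hS x hx.1 u hu
  refine ⟨mem_sdiff.2 ⟨huS, fun huv => hx.2 ?_⟩, hxu⟩
  rw [← component_eq_of_mem huv, mem_component]
  exact ⟨hxu, hu⟩

theorem componentSign_union_component {A : Finset (α × α)} {S : Finset α} {v : α}
    (hS : IsSourceUnion A S) (hv : v ∉ S) :
    componentSign A (S ∪ component A v) = -componentSign A S := by
  have himage : (component A v).image (component A) = {component A v} := by
    ext K
    simp only [mem_image, mem_singleton]
    constructor
    · rintro ⟨x, hx, rfl⟩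
      exact component_eq_of_mem hx
    · rintro rfl
      exact ⟨v, self_mem_component A v, rfl⟩
  have hnot : component A v ∉ S.image (component A) := by
    rw [mem_image]
    rintro ⟨x, hx, hxv⟩
    exact hv (hS.component_subset hx (hxv ▸ self_mem_component A v))
  unfold componentSign
  rw [image_union, himage, union_comm, ← insert_eq, card_insert_of_notMem hnot, pow_succ]
  ring

open Classical in
/-- In a nonempty digraph, the signed count of unions of source components vanishes. -/
theorem sum_componentSign_eq_zero {A : Finset (α × α)} {W : Finset α} (hA : A ⊆ W.offDiag)
    (hW : W.Nonempty) :
    ∑ S ∈ W.powerset with IsSourceUnion A S, componentSign A S = 0 := by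
  obtain ⟨v, hvW, hv⟩ := exists_source A hA hW
  have hKW : component A v ⊆ W := fun u hu =>
    (mem_component.1 hu).1.mem_of_subset_offDiag hA hvW
  -- Adding or removing the source component of `v` pairs the `S` avoiding `v` with those containing
  -- it.
  rw [← sum_filter_not_add_sum_filter _ (fun S => v ∈ S), ← eq_neg_iff_add_eq_zero,
    ← sum_neg_distrib]
  refine sum_nbij' (fun S => S ∪ component A v) (fun S => S \ component A v) ?_ ?_ ?_ ?_ ?_
  · intro S hS
    simp only [mem_filter, mem_powerset] at hS ⊢
    exact ⟨⟨union_subset hS.1.1 hKW, isSourceUnion_union_component hv hS.1.2⟩,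
      mem_union_right _ (self_mem_component A v)⟩
  · intro S hS
    simp only [mem_filter, mem_powerset] at hS ⊢
    exact ⟨⟨sdiff_subset.trans hS.1.1, isSourceUnion_sdiff_component hS.1.2⟩,
      fun h => (mem_sdiff.1 h).2 (self_mem_component A v)⟩
  · intro S hS
    simp only [mem_filter, mem_powerset] at hS
    exact union_sdiff_cancel_right (hS.1.2.disjoint_component hS.2)
  · intro S hS
    simp only [mem_filter, mem_powerset] at hS
    exact sdiff_union_of_subset (hS.1.2.component_subset hS.2)
  · intro S hS
    simp only [mem_filter, mem_powerset] at hS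
    rw [componentSign_union_component hS.1.2 hS.2, neg_neg]

end Reachability

/-! ### Weighted counts and their recursions -/

section Weights

variable {α : Type*} [DecidableEq α]

theorem sum_powerset_union {β M : Type*} [DecidableEq β] [AddCommMonoid M] {P R : Finset β}
    (h : Disjoint P R) (f : Finset β → M) :
    ∑ A ∈ (P ∪ R).powerset, f A = ∑ A ∈ P.powerset, ∑ B ∈ R.powerset, f (A ∪ B) := by
  rw [← sum_product']
  symm
  refine sum_nbij' (fun p => p.1 ∪ p.2) (fun A => (A ∩ P, A ∩ R)) ?_ ?_ ?_ ?_ ?_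
  · intro p hp
    simp only [mem_product, mem_powerset] at hp ⊢
    exact union_subset_union hp.1 hp.2
  · intro A _
    simp
  · rintro ⟨A, B⟩ hp
    simp only [mem_product, mem_powerset] at hp
    have h1 := disjoint_of_subset_right hp.2 h
    have h2 := disjoint_of_subset_left hp.1 h
    rw [disjoint_left] at h1 h2
    ext x
    · simp only [mem_inter, mem_union]
      exact ⟨fun hx => hx.1.resolve_right fun hB => h1 hx.2 hB, fun hx => ⟨.inl hx, hp.1 hx⟩⟩
    · simp only [mem_inter, mem_union]
      exact ⟨fun hx => hx.1.resolve_left fun hB => h2 hB hx.2, fun hx => ⟨.inr hx, hp.2 hx⟩⟩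
  · intro A hA
    simp only [mem_powerset] at hA
    rw [← inter_union_distrib_left, inter_eq_left.2 hA]
  · intro p _
    rfl

theorem sum_powerset_X_pow_card {β : Type*} (R : Finset β) :
    ∑ B ∈ R.powerset, (X : ℚ[X]) ^ #B = (1 + X) ^ #R := by
  rw [add_comm, ← sum_pow_mul_eq_add_pow]
  simp

/-- Each of the `#W - #S` heads outside `S` admits every other vertex of `W` as tail. -/
theorem card_filter_snd_notMem {S W : Finset α} (hS : S ⊆ W) :
    #{p ∈ W.offDiag | p.2 ∉ S} = (#W - #S) * (#W - 1) := by
  have h : #{p ∈ W.offDiag | p.2 ∉ S} = ∑ v ∈ W \ S, #{p ∈ W.offDiag | p.2 = v} := by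
    rw [card_eq_sum_card_fiberwise (f := Prod.snd) (t := W \ S)]
    · refine sum_congr rfl fun v hv => ?_
      rw [filter_filter]
      congr 1
      ext p
      simp only [mem_filter, mem_sdiff] at hv ⊢
      constructor
      · rintro ⟨h1, _, h3⟩; exact ⟨h1, h3⟩
      · rintro ⟨h1, rfl⟩; exact ⟨h1, hv.2, rfl⟩
    · intro p hp
      simp only [coe_filter, Set.mem_ofPred_eq, mem_offDiag] at hp
      simp [hp.1.2.1, hp.2]
  rw [h, sum_const_nat (m := #W - 1), card_sdiff_of_subset hS]
  intro v hv
  have hvW := (mem_sdiff.1 hv).1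
  rw [← card_erase_of_mem hvW]
  refine card_nbij' Prod.fst (fun u => (u, v)) ?_ ?_ ?_ ?_
  · intro p hp
    simp only [coe_filter, Set.mem_ofPred_eq, mem_offDiag] at hp
    simp only [coe_erase, Set.mem_sdiff, SetLike.mem_coe, Set.mem_singleton_iff]
    exact ⟨hp.1.1, hp.2 ▸ hp.1.2.2⟩
  · intro u hu
    simp only [coe_erase, Set.mem_sdiff, SetLike.mem_coe, Set.mem_singleton_iff] at hu
    simp [hu.1, hu.2, hvW]
  · rintro ⟨a, b⟩ hp
    simp only [coe_filter, Set.mem_ofPred_eq] at hp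
    simp [hp.2]
  · intro u _
    rfl

open Classical in
/-- The weighted count of strongly connected digraphs on `K`. -/
noncomputable def strongWeight (K : Finset α) : ℚ[X] :=
  ∑ A ∈ K.offDiag.powerset with IsStrongOn A K, X ^ #A

open Classical in
/-- The weighted count, signed by the number of components, of disjoint unions of strongly
connected digraphs on `S`. -/
noncomputable def signedWeight [Fintype α] (S : Finset α) : ℚ[X] :=
  ∑ A ∈ S.offDiag.powerset with IsSourceUnion A S, componentSign A S * X ^ #A

variable [Fintype α]

open Classical in
theorem signedWeight_mul_eq {S W : Finset α} (hS : S ⊆ W) :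
    signedWeight S * (1 + X) ^ ((#W - #S) * (#W - 1)) =
      ∑ A ∈ W.offDiag.powerset with IsSourceUnion A S, componentSign A S * X ^ #A := by
  set R : Finset (α × α) := {p ∈ W.offDiag | p.2 ∉ S} with hR
  have hdisj : Disjoint S.offDiag R := by
    rw [disjoint_left]
    intro p hp hpR
    exact (mem_filter.1 hpR).2 (mem_offDiag.1 hp).2.1
  have hsub : S.offDiag ∪ R ⊆ W.offDiag :=
    union_subset (offDiag_mono hS) (filter_subset _ _)
  have hR' : ∀ B ⊆ R, ∀ p ∈ B, p.2 ∉ S := fun B hB p hp => (mem_filter.1 (hB hp)).2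
  -- No arc enters a source union from outside, so only arcs within `S` and arcs with head outside
  -- `S` can occur.
  have hfilter : (W.offDiag.powerset.filter fun A => IsSourceUnion A S) =
      (S.offDiag ∪ R).powerset.filter fun A => IsSourceUnion A S := by
    ext A
    simp only [mem_filter, mem_powerset]
    refine ⟨fun h => ⟨fun p hp => ?_, h.2⟩, fun h => ⟨h.1.trans hsub, h.2⟩⟩
    by_cases hpS : p.2 ∈ S
    · have h1 := (h.2 p.2 hpS p.1 (Relation.ReflTransGen.single hp)).1
      exact mem_union_left _ (mem_offDiag.2 ⟨h1, hpS, (mem_offDiag.1 (h.1 hp)).2.2⟩)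
    · exact mem_union_right _ (mem_filter.2 ⟨h.1 hp, hpS⟩)
  rw [hfilter, sum_filter, sum_powerset_union hdisj, ← card_filter_snd_notMem hS,
    ← sum_powerset_X_pow_card, signedWeight, sum_filter, sum_mul_sum]
  refine sum_congr rfl fun A hA => sum_congr rfl fun B hB => ?_
  rw [mem_powerset] at hA hB
  rw [isSourceUnion_union_iff hA (hR' B hB), componentSign_union_eq hA (hR' B hB),
    card_union_of_disjoint (disjoint_of_subset_left hA (disjoint_of_subset_right hB hdisj)),
    pow_add]
  split_ifs <;> ring

theorem sum_signedWeight_mul (W : Finset α) :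
    ∑ S ∈ W.powerset, signedWeight S * (1 + X) ^ ((#W - #S) * (#W - 1)) =
      if #W = 0 then 1 else 0 := by
  classical
  split_ifs with hW
  · rw [card_eq_zero] at hW
    subst hW
    rw [powerset_empty, sum_singleton, signedWeight, offDiag_empty, powerset_empty,
      filter_singleton, if_pos (by simp [IsSourceUnion]), sum_singleton]
    simp [componentSign]
  · have hW' : W.Nonempty := card_ne_zero.1 hW
    rw [sum_congr rfl fun S hS => signedWeight_mul_eq (mem_powerset.1 hS)]
    simp only [sum_filter]
    rw [sum_comm]
    refine sum_eq_zero fun A hA => ?_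
    rw [← sum_filter, ← sum_mul, sum_componentSign_eq_zero (mem_powerset.1 hA) hW', zero_mul]

/-- A disjoint union of strongly connected digraphs on `K ∪ L` with `K` one of the components. -/
theorem isSourceUnion_union_component_iff {A B : Finset (α × α)} {K L : Finset α} {v : α}
    (hA : A ⊆ K.offDiag) (hB : B ⊆ L.offDiag) (hKL : Disjoint K L) (hv : v ∈ K) :
    (IsSourceUnion (A ∪ B) (K ∪ L) ∧ component (A ∪ B) v = K) ↔
      IsStrongOn A K ∧ IsSourceUnion B L := by
  have hB' : ∀ p ∈ B, p.2 ∉ K := fun p hp =>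
    disjoint_right.1 hKL (mem_offDiag.1 (hB hp)).2.1
  have hA' : ∀ p ∈ A, p.2 ∉ L := fun p hp =>
    disjoint_left.1 hKL (mem_offDiag.1 (hA hp)).2.1
  have hRK : ∀ u, ∀ w ∈ K, (Reach (A ∪ B) u w ↔ Reach A u w) := fun u w hw =>
    reach_union_iff hA hB' hw
  have hRL : ∀ u, ∀ w ∈ L, (Reach (A ∪ B) u w ↔ Reach B u w) := fun u w hw => by
    rw [union_comm]; exact reach_union_iff hB hA' hw
  constructor
  · rintro ⟨hS, hK⟩
    refine ⟨fun u hu w hw => ?_, fun w hw u hu => ?_⟩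
    · rw [← hRK u w hw]
      rw [← hK, mem_component] at hu hw
      exact hu.1.trans hw.2
    · have huL := hu.mem_of_subset_offDiag hB hw
      exact ⟨huL, (hRL w u huL).1 (hS w (mem_union_right _ hw) u ((hRL u w hw).2 hu)).2⟩
  · rintro ⟨hK, hL⟩
    refine ⟨fun w hw u hu => ?_, ?_⟩
    · rcases mem_union.1 hw with hw | hw
      · rw [hRK u w hw] at hu
        have huK := hu.mem_of_subset_offDiag hA hw
        exact ⟨mem_union_left _ huK, (hRK w u huK).2 (hK w hw u huK)⟩
      · rw [hRL u w hw] at hu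
        obtain ⟨huL, hwu⟩ := hL w hw u hu
        exact ⟨mem_union_right _ huL, (hRL w u huL).2 hwu⟩
    · ext u
      rw [mem_component, hRK u v hv]
      refine ⟨fun hu => hu.1.mem_of_subset_offDiag hA hv, fun hu => ⟨hK u hu v hv, ?_⟩⟩
      rw [hRK v u hu]
      exact hK v hv u hu

/-- Every arc can be reversed by a path, so its two ends share a component and none crosses between
`K` and `S \ K`. -/
theorem subset_union_offDiag_of_component_eq {A : Finset (α × α)} {S K : Finset α} {v : α}
    (hA : A ⊆ S.offDiag) (hS : IsSourceUnion A S) (hK : component A v = K) :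
    A ⊆ K.offDiag ∪ (S \ K).offDiag := by
  rintro ⟨a, b⟩ hp
  obtain ⟨haS, hbS, hab⟩ := mem_offDiag.1 (hA hp)
  have hreach : Reach A a b := Relation.ReflTransGen.single hp
  have hba := (hS b hbS a hreach).2
  have hcomp : component A a = component A b :=
    component_eq_of_mem (mem_component.2 ⟨hreach, hba⟩)
  have hiff : a ∈ K ↔ b ∈ K := by
    subst hK
    rw [mem_component, mem_component]
    exact ⟨fun h => ⟨hba.trans h.1, h.2.trans hreach⟩, fun h => ⟨hreach.trans h.1, h.2.trans hba⟩⟩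
  by_cases haK : a ∈ K
  · exact mem_union_left _ (mem_offDiag.2 ⟨haK, hiff.1 haK, hab⟩)
  · exact mem_union_right _ (mem_offDiag.2
      ⟨mem_sdiff.2 ⟨haS, haK⟩, mem_sdiff.2 ⟨hbS, fun h => haK (hiff.2 h)⟩, hab⟩)

open Classical in
theorem sum_component_eq {S K : Finset α} {v : α} (hK : K ⊆ S) (hv : v ∈ K) :
    ∑ A ∈ S.offDiag.powerset with IsSourceUnion A S ∧ component A v = K,
      componentSign A S * X ^ #A = -(strongWeight K * signedWeight (S \ K)) := by
  have hKL : Disjoint K (S \ K) := disjoint_sdiff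
  have hdisj : Disjoint K.offDiag (S \ K).offDiag := by
    rw [disjoint_left]
    intro p hp hp'
    exact disjoint_left.1 hKL (mem_offDiag.1 hp).1 (mem_offDiag.1 hp').1
  have hfilter : (S.offDiag.powerset.filter fun A => IsSourceUnion A S ∧ component A v = K) =
      (K.offDiag ∪ (S \ K).offDiag).powerset.filter
        fun A => IsSourceUnion A S ∧ component A v = K := by
    ext A
    simp only [mem_filter, mem_powerset]
    exact ⟨fun h => ⟨subset_union_offDiag_of_component_eq h.1 h.2.1 h.2.2, h.2⟩,
      fun h => ⟨h.1.trans (union_subset (offDiag_mono hK) (offDiag_mono sdiff_subset)), h.2⟩⟩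
  rw [hfilter, sum_filter, sum_powerset_union hdisj, strongWeight, signedWeight, sum_filter,
    sum_filter, sum_mul_sum, ← sum_neg_distrib]
  refine sum_congr rfl fun A hA => ?_
  rw [← sum_neg_distrib]
  refine sum_congr rfl fun B hB => ?_
  rw [mem_powerset] at hA hB
  have hiff := isSourceUnion_union_component_iff hA hB hKL hv
  rw [union_sdiff_of_subset hK] at hiff
  by_cases h : IsStrongOn A K ∧ IsSourceUnion B (S \ K)
  · obtain ⟨hS, hcomp⟩ := hiff.2 h
    have hsign : componentSign (A ∪ B) S = -componentSign B (S \ K) := by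
      have hL : IsSourceUnion (A ∪ B) (S \ K) := by
        have := isSourceUnion_sdiff_component (v := v) hS
        rwa [hcomp] at this
      have := componentSign_union_component hL (v := v) (fun h => (mem_sdiff.1 h).2 hv)
      rw [hcomp, sdiff_union_of_subset hK] at this
      rw [this, union_comm, componentSign_union_eq hB]
      exact fun p hp => disjoint_left.1 hKL (mem_offDiag.1 (hA hp)).2.1
    rw [if_pos ⟨hS, hcomp⟩, if_pos h.1, if_pos h.2, hsign,
      card_union_of_disjoint (disjoint_of_subset_left hA (disjoint_of_subset_right hB hdisj)),
      pow_add]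
    ring
  · rw [if_neg (hiff.not.2 h)]
    rw [not_and_or] at h
    rcases h with h | h <;> simp [h]

/-- Splitting off the component of a vertex. -/
theorem signedWeight_insert {S : Finset α} {v : α} (hv : v ∉ S) :
    signedWeight (insert v S) =
      -∑ K ∈ S.powerset, strongWeight (insert v K) * signedWeight (S \ K) := by
  classical
  -- The sum is grouped by the component of `v`, with `v` erased so that the index runs over subsets
  -- of `S`.
  have hmaps : ∀ A ∈ (insert v S).offDiag.powerset.filter fun A => IsSourceUnion A (insert v S),
      (component A v).erase v ∈ S.powerset := by
    intro A hA
    rw [mem_filter] at hA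
    rw [mem_powerset, ← subset_insert_iff]
    exact hA.2.component_subset (mem_insert_self v S)
  rw [signedWeight, ← sum_fiberwise_of_maps_to hmaps, ← sum_neg_distrib]
  refine sum_congr rfl fun K hK => ?_
  rw [mem_powerset] at hK
  have hvK : v ∉ K := fun h => hv (hK h)
  have hsdiff : S \ K = insert v S \ insert v K := by
    ext x
    simp only [mem_sdiff, mem_insert]
    constructor
    · rintro ⟨h1, h2⟩
      exact ⟨.inr h1, not_or.2 ⟨fun h => hv (h ▸ h1), h2⟩⟩
    · rintro ⟨h1, h2⟩
      rw [not_or] at h2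
      exact ⟨h1.resolve_left h2.1, h2.2⟩
  rw [hsdiff, ← sum_component_eq (insert_subset_insert v hK) (mem_insert_self v K), filter_filter]
  refine sum_congr (filter_congr fun A _ => and_congr_right fun _ => ?_) fun _ _ => rfl
  constructor
  · rintro rfl
    rw [insert_erase (self_mem_component A v)]
  · intro h
    rw [h, erase_insert hvK]

end Weights

/-! ### Transport to labelled digraphs on `Fin n` -/

/-- The weighted count of strongly connected digraphs depends only on the number of vertices. -/
theorem strongWeight_eq_sccPoly {α : Type*} {K : Finset α} (hK : K.Nonempty) :
    strongWeight K = sccPoly #K := by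
  classical
  set f : Fin #K → α := fun i => (K.equivFin.symm i : α) with hf
  have hfinj : Function.Injective f := Subtype.val_injective.comp K.equivFin.symm.injective
  have hfmem : ∀ i, f i ∈ K := fun i => (K.equivFin.symm i).2
  have hfsurj : ∀ x ∈ K, ∃ i, f i = x := fun x hx => ⟨K.equivFin ⟨x, hx⟩, by simp [hf]⟩
  set F : Fin #K × Fin #K ↪ α × α := ⟨Prod.map f f, hfinj.prodMap hfinj⟩ with hF
  set arcs : Digraph (Fin #K) → Finset (α × α) :=
    fun D => (univ.filter fun p : Fin #K × Fin #K => D.Adj p.1 p.2).map F with harcs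
  have hmem : ∀ D i j, (f i, f j) ∈ arcs D ↔ D.Adj i j := by
    intro D i j
    have : (f i, f j) = F (i, j) := rfl
    rw [this, harcs, mem_map' F]
    simp
  have hmem' : ∀ D p, p ∈ arcs D → ∃ i j, D.Adj i j ∧ (f i, f j) = p := by
    intro D p hp
    obtain ⟨⟨i, j⟩, hq, rfl⟩ := mem_map.1 hp
    exact ⟨i, j, (mem_filter.1 hq).2, rfl⟩
  have hreach : ∀ D i j, Reach (arcs D) (f i) (f j) ↔ Relation.ReflTransGen D.Adj i j := by
    intro D i j
    constructor
    · intro h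
      generalize hx : f i = x at h
      induction h using Relation.ReflTransGen.head_induction_on generalizing i with
      | refl => rw [hfinj hx]
      | head hab _ ih =>
        obtain ⟨a, b, hadj, heq⟩ := hmem' D _ hab
        obtain ⟨rfl, rfl⟩ := Prod.mk.inj heq
        rw [hfinj hx]
        exact Relation.ReflTransGen.head hadj (ih b rfl)
    · exact fun h => Relation.ReflTransGen.lift f (fun a b hab => (hmem D a b).2 hab) _ _ h
  symm
  unfold sccPoly strongWeight
  refine sum_bij (fun D _ => arcs D) ?_ ?_ ?_ ?_
  · intro D hD
    simp only [mem_filter, mem_univ, true_and, mem_powerset] at hD ⊢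
    refine ⟨fun p hp => ?_, fun u hu v hv => ?_⟩
    · obtain ⟨i, j, hij, rfl⟩ := hmem' D p hp
      exact mem_offDiag.2 ⟨hfmem i, hfmem j, fun h => hD.1 i (by rwa [← hfinj h] at hij)⟩
    · obtain ⟨i, rfl⟩ := hfsurj u hu
      obtain ⟨j, rfl⟩ := hfsurj v hv
      exact (hreach D i j).2 (hD.2.2 i j)
  · intro D _ D' _ h
    ext i j
    rw [← hmem D, ← hmem D', h]
  · intro A hA
    simp only [mem_filter, mem_powerset] at hA
    have harcsA : arcs ⟨fun i j => (f i, f j) ∈ A⟩ = A := by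
      ext p
      constructor
      · intro hp
        obtain ⟨i, j, hij, rfl⟩ := hmem' _ p hp
        exact hij
      · intro hp
        obtain ⟨h1, h2, _⟩ := mem_offDiag.1 (hA.1 hp)
        obtain ⟨i, hi⟩ := hfsurj _ h1
        obtain ⟨j, hj⟩ := hfsurj _ h2
        have hpe : p = (f i, f j) := Prod.ext hi.symm hj.symm
        rw [hpe] at hp ⊢
        exact (hmem _ i j).2 hp
    refine ⟨⟨fun i j => (f i, f j) ∈ A⟩, ?_, harcsA⟩
    simp only [mem_filter, mem_univ, true_and]
    -- Nonemptiness matters: on the empty set `strongWeight` is `1`, while `sccPoly 0` is `0`.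
    refine ⟨fun i hi => (mem_offDiag.1 (hA.1 hi)).2.2 rfl, card_pos.2 hK, fun i j => ?_⟩
    rw [← hreach, harcsA]
    exact hA.2 _ (hfmem i) _ (hfmem j)
  · intro D _
    rw [harcs, card_map, numArcs, Set.ncard_eq_toFinset_card', Set.toFinset_ofPred]

end DigraphEGF

namespace DigraphEGF

open Polynomial Finset

/-! ### Generating functions and the logarithm -/

section Series

theorem graphPoly_eq (n : ℕ) : graphPoly n = (1 + X) ^ n.choose 2 := by
  classical
  set E : Finset (Sym2 (Fin n)) := univ.filter fun e => ¬ e.IsDiag with hE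
  have hcard : #E = n.choose 2 := by
    have := Sym2.card_subtype_not_diag (α := Fin n)
    rwa [Fintype.card_subtype, Fintype.card_fin] at this
  have hEset : ∀ A ∈ E.powerset, (A : Set (Sym2 (Fin n))) \ Sym2.diagSet = A := by
    intro A hA
    rw [sdiff_eq_left, Set.disjoint_left]
    intro e he hd
    exact (mem_filter.1 (mem_powerset.1 hA he)).2 hd
  rw [← hcard, ← sum_powerset_X_pow_card, graphPoly]
  refine sum_nbij' (fun H => H.edgeFinset) (fun A => SimpleGraph.fromEdgeSet (A : Set _))
    ?_ ?_ ?_ ?_ ?_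
  · intro H _
    rw [mem_powerset]
    intro e he
    rw [SimpleGraph.mem_edgeFinset] at he
    exact mem_filter.2 ⟨mem_univ _, H.not_isDiag_of_mem_edgeSet he⟩
  · intro A _
    exact mem_univ _
  · intro H _
    simp
  · intro A hA
    rw [← coe_inj, SimpleGraph.coe_edgeFinset, SimpleGraph.edgeSet_fromEdgeSet, hEset A hA]
  · intro H _
    rw [← SimpleGraph.coe_edgeFinset, Set.ncard_coe_finset]

theorem coeff_egf (a : ℕ → ℚ[X]) (n : ℕ) :
    PowerSeries.coeff n (egf a) = C ((n.factorial : ℚ)⁻¹) * a n :=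
  PowerSeries.coeff_mk _ _

theorem C_inv_factorial_mul (n : ℕ) :
    C ((n.factorial : ℚ)⁻¹) * (n.factorial : ℚ[X]) = 1 := by
  rw [← C_eq_natCast, ← C_mul, inv_mul_cancel₀ (Nat.cast_ne_zero.2 n.factorial_ne_zero), C_1]

theorem factorial_mul_coeff_egf (a : ℕ → ℚ[X]) (n : ℕ) :
    (n.factorial : ℚ[X]) * PowerSeries.coeff n (egf a) = a n := by
  rw [coeff_egf, ← mul_assoc, mul_comm (n.factorial : ℚ[X]), C_inv_factorial_mul, one_mul]

theorem egf_factorial_mul_coeff (A : PowerSeries ℚ[X]) :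
    egf (fun n => (n.factorial : ℚ[X]) * PowerSeries.coeff n A) = A := by
  ext1 n
  rw [coeff_egf, ← mul_assoc, C_inv_factorial_mul, one_mul]

theorem egf_mul_egf (a b : ℕ → ℚ[X]) :
    egf a * egf b = egf fun n => ∑ k ∈ range (n + 1), n.choose k • (a k * b (n - k)) := by
  ext1 n
  rw [PowerSeries.coeff_mul, Nat.sum_antidiagonal_eq_sum_range_succ_mk, coeff_egf, mul_sum]
  refine sum_congr rfl fun k hk => ?_
  have hkn : k ≤ n := Nat.lt_succ_iff.1 (mem_range.1 hk)
  have hq : (k.factorial : ℚ)⁻¹ * ((n - k).factorial : ℚ)⁻¹ =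
      (n.factorial : ℚ)⁻¹ * (n.choose k : ℚ) := by
    rw [Nat.cast_choose ℚ hkn]
    have := n.factorial_ne_zero
    field_simp
  rw [coeff_egf, coeff_egf, nsmul_eq_mul, ← C_eq_natCast, ← mul_assoc (C _) (C _), ← C_mul, ← hq,
    C_mul]
  ring

theorem derivative_egf (a : ℕ → ℚ[X]) :
    PowerSeries.derivative ℚ[X] (egf a) = egf fun n => a (n + 1) := by
  ext1 n
  rw [PowerSeries.coeff_derivative, coeff_egf, coeff_egf]
  have hq : ((n + 1).factorial : ℚ)⁻¹ * ((n + 1 : ℕ) : ℚ) = (n.factorial : ℚ)⁻¹ := by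
    rw [Nat.factorial_succ, Nat.cast_mul]
    have := n.factorial_ne_zero
    field_simp
  rw [← hq, C_mul, C_eq_natCast]
  push_cast
  ring

/-- The logarithmic derivative of a series with constant term `1`. -/
theorem mul_derivative_logOf {R : Type*} [CommRing R] [Algebra ℚ R] {f : PowerSeries R}
    (hf : PowerSeries.constantCoeff f = 1) :
    f * PowerSeries.derivative R (PowerSeries.logOf f) = PowerSeries.derivative R f := by
  have hs : PowerSeries.HasSubst (f - 1) :=
    PowerSeries.HasSubst.of_constantCoeff_zero' (by simp [hf])
  -- The derivative of `log (1 + X)` is the geometric series of `-X`; substituting `f - 1` turns `1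
  -- + X` into `f`.
  have hgeom : (1 + PowerSeries.X) *
      PowerSeries.derivative R (PowerSeries.log R) = 1 := by
    rw [PowerSeries.deriv_log]
    ext1 n
    rw [add_mul, one_mul, map_add]
    cases n with
    | zero => simp
    | succ n => simp [PowerSeries.coeff_succ_X_mul, PowerSeries.coeff_one, pow_succ]
  have hsub := congrArg (PowerSeries.subst (f - 1)) hgeom
  rw [PowerSeries.subst_mul hs, PowerSeries.subst_add hs, PowerSeries.subst_X hs,
    ← PowerSeries.coe_substAlgHom hs, map_one, add_sub_cancel, PowerSeries.coe_substAlgHom hs]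
    at hsub
  rw [PowerSeries.logOf_eq, PowerSeries.derivative_subst hs, ← mul_assoc, hsub, one_mul, map_sub,
    PowerSeries.derivative_one, sub_zero]

theorem G_eq : G = egf fun n => (1 + X) ^ n.choose 2 := by
  rw [G, funext graphPoly_eq]

theorem constantCoeff_G : PowerSeries.constantCoeff G = 1 := by
  rw [← PowerSeries.coeff_zero_eq_constantCoeff_apply, G_eq, coeff_egf]
  simp

/-- The coefficient of `zⁿ / n!` in `G ⊙ (1 / G)`. -/
noncomputable def hadamardCoeff (n : ℕ) : ℚ[X] :=
  (1 + X) ^ n.choose 2 * ((n.factorial : ℚ[X]) * PowerSeries.coeff n (recip G))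

theorem hadamard_eq : hadamard G (recip G) = egf hadamardCoeff := by
  unfold hadamard
  congr 1
  funext n
  rw [hadamardCoeff]
  congr 1
  rw [G_eq, factorial_mul_coeff_egf]

/-- With `n = k + t`, this exchanges the exponents from `G` for the number of free arcs `(n - k)(n -
1)`. -/
theorem choose_two_add (k t : ℕ) :
    (k + t).choose 2 + t.choose 2 = k.choose 2 + t * (k + t - 1) := by
  have h : ∀ m : ℕ, m.choose 2 * 2 = m * (m - 1) := fun m => by
    rw [Nat.choose_two_right, Nat.div_mul_cancel (Nat.even_mul_pred_self m).two_dvd]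
  have h1 := h (k + t)
  have h2 := h t
  have h3 := h k
  rcases k with _ | k
  · simp only [zero_add] at *
    simp only [Nat.choose_zero_succ] at *
    omega
  rcases t with _ | t
  · simp
  have e1 : k + 1 + (t + 1) - 1 = k + t + 1 := by omega
  rw [e1] at h1 ⊢
  simp only [Nat.add_sub_cancel] at h2 h3
  nlinarith

theorem sum_choose_hadamardCoeff (n : ℕ) :
    ∑ k ∈ range (n + 1), n.choose k • (hadamardCoeff k * (1 + X) ^ ((n - k) * (n - 1))) =
      if n = 0 then 1 else 0 := by
  have h := mul_recip G constantCoeff_G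
  rw [mul_comm, ← egf_factorial_mul_coeff (recip G), G_eq, egf_mul_egf, ← G_eq] at h
  have hn := congrArg (fun A => (n.factorial : ℚ[X]) * PowerSeries.coeff n A) h
  simp only [factorial_mul_coeff_egf, PowerSeries.coeff_one] at hn
  have hn' := congrArg (fun p => (1 + X) ^ n.choose 2 * p) hn
  simp only [mul_sum] at hn'
  refine Eq.trans (sum_congr rfl fun k hk => ?_) (hn'.trans ?_)
  · have hkn : k ≤ n := Nat.lt_succ_iff.1 (mem_range.1 hk)
    have hexp := choose_two_add k (n - k)
    rw [Nat.add_sub_cancel' hkn] at hexp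
    have hpow := congrArg (fun m => (1 + X : ℚ[X]) ^ m) hexp
    simp only [pow_add] at hpow
    rw [hadamardCoeff, nsmul_eq_mul, nsmul_eq_mul]
    linear_combination (-(n.choose k : ℚ[X]) * ((k.factorial : ℚ[X]) *
      PowerSeries.coeff k (recip G))) * hpow
  · split_ifs with h0
    · subst h0
      simp
    · simp

/-- Both sides satisfy the same recursion, which determines them because the term `S = W` has factor
`(1 + X) ^ 0 = 1`. -/
theorem signedWeight_eq_hadamardCoeff {α : Type*} [DecidableEq α] [Fintype α] (W : Finset α) :
    signedWeight W = hadamardCoeff #W := by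
  induction W using Finset.strongInduction with
  | H W ih =>
    have h := (sum_signedWeight_mul W).trans (sum_choose_hadamardCoeff #W).symm
    rw [← sum_powerset_apply_card
      (fun k => hadamardCoeff k * (1 + X : ℚ[X]) ^ ((#W - k) * (#W - 1))),
      ← sum_erase_add _ _ (mem_powerset_self W),
      ← sum_erase_add _ (fun S => hadamardCoeff #S * _) (mem_powerset_self W)] at h
    have hproper : ∑ S ∈ W.powerset.erase W,
        signedWeight S * (1 + X) ^ ((#W - #S) * (#W - 1)) =
        ∑ S ∈ W.powerset.erase W, hadamardCoeff #S * (1 + X) ^ ((#W - #S) * (#W - 1)) :=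
      sum_congr rfl fun S hS => by
        rw [ih S (Finset.ssubset_iff_subset_ne.2
          ⟨mem_powerset.1 (mem_of_mem_erase hS), ne_of_mem_erase hS⟩)]
    rw [hproper] at h
    have hW := add_left_cancel h
    simpa using hW

theorem hadamardCoeff_zero : hadamardCoeff 0 = 1 := by
  simpa using sum_choose_hadamardCoeff 0

/-- The vertex `0` is marked; `k` counts the other vertices of its component. -/
theorem hadamardCoeff_succ (n : ℕ) :
    hadamardCoeff (n + 1) =
      -∑ k ∈ range (n + 1), n.choose k • (sccPoly (k + 1) * hadamardCoeff (n - k)) := by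
  have hS : (0 : Fin (n + 1)) ∉ (univ : Finset (Fin (n + 1))).erase 0 := notMem_erase _ _
  have hcard : #((univ : Finset (Fin (n + 1))).erase 0) = n := by simp
  have h := signedWeight_insert hS
  rw [signedWeight_eq_hadamardCoeff, card_insert_of_notMem hS, hcard] at h
  rw [h]
  congr 1
  trans ∑ K ∈ ((univ : Finset (Fin (n + 1))).erase 0).powerset,
    sccPoly (#K + 1) * hadamardCoeff (n - #K)
  · refine sum_congr rfl fun K hK => ?_
    rw [mem_powerset] at hK
    rw [strongWeight_eq_sccPoly (insert_nonempty _ _), signedWeight_eq_hadamardCoeff,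
      card_insert_of_notMem fun h => hS (hK h), card_sdiff_of_subset hK, hcard]
  · rw [sum_powerset_apply_card fun k => sccPoly (k + 1) * hadamardCoeff (n - k), hcard]

theorem constantCoeff_hadamard : PowerSeries.constantCoeff (hadamard G (recip G)) = 1 := by
  rw [← PowerSeries.coeff_zero_eq_constantCoeff_apply, hadamard_eq, coeff_egf, hadamardCoeff_zero]
  simp

theorem sccPoly_zero : sccPoly 0 = 0 := by
  simp [sccPoly, StronglyConnected]

theorem derivative_hadamard :
    PowerSeries.derivative ℚ[X] (hadamard G (recip G)) =
      -(hadamard G (recip G) * PowerSeries.derivative ℚ[X] SCC) := by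
  rw [hadamard_eq, SCC, derivative_egf, derivative_egf, mul_comm, egf_mul_egf]
  ext1 n
  rw [map_neg, coeff_egf, coeff_egf, hadamardCoeff_succ, mul_neg]

theorem SCC_eq : SCC = -PowerSeries.logOf (hadamard G (recip G)) := by
  have hne : hadamard G (recip G) ≠ 0 := fun h => by
    simpa [h] using constantCoeff_hadamard
  -- Multiplying the derivatives by the nonzero series `G ⊙ (1/G)` avoids dividing by it; `ℚ[X]⟦X⟧`
  -- is a domain.
  refine PowerSeries.derivative.ext (mul_left_cancel₀ hne ?_) ?_
  · rw [map_neg, mul_neg, mul_derivative_logOf constantCoeff_hadamard, derivative_hadamard, neg_neg]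
  · rw [map_neg, PowerSeries.constantCoeff_logOf constantCoeff_hadamard, neg_zero, SCC,
      ← PowerSeries.coeff_zero_eq_constantCoeff_apply, coeff_egf, sccPoly_zero, mul_zero]

end Series

end DigraphEGF

theorem corollary3p5 :
    DigraphEGF.G =
        DigraphEGF.egf (fun n => (1 + (Polynomial.X : Polynomial ℚ)) ^ n.choose 2) ∧
      DigraphEGF.G * DigraphEGF.recip DigraphEGF.G = 1 ∧
      PowerSeries.constantCoeff
        (DigraphEGF.hadamard DigraphEGF.G (DigraphEGF.recip DigraphEGF.G)) = 1 ∧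
      DigraphEGF.SCC =
        -PowerSeries.logOf (DigraphEGF.hadamard DigraphEGF.G (DigraphEGF.recip DigraphEGF.G)) := by
  exact ⟨DigraphEGF.G_eq, DigraphEGF.mul_recip _ DigraphEGF.constantCoeff_G,
    DigraphEGF.constantCoeff_hadamard, DigraphEGF.SCC_eq⟩
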